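/- An anonymous quantum network consists of $n \ge 1$ parties placed at the nodes of a connected undirected simple graph $G$, with a bidirectional quantum communication link on every edge and no prior entanglement. A node of degree $d$ accesses its links through $d$ ports, labelled by an arbitrary bijection (a port numbering, chosen independently at each node). All parties run the same algorithm, whose only arguments are $n$ and the number $d$ of ports of the party. In every synchronous round each party applies a physically realizable operation (a unitary on a finite-dimensional system, measurements being deferred to the end) to its local system and the incoming messages, and then sends out messages of qubits through its ports. Round complexity is the number of rounds; bit complexity is the total number of qubits sent over all links, where a message whose length is in superposition is counted with the largest length that has nonzero amplitude. The leader election problem is exactly solved if, when every party $i$ finally measures its bit $y_i$ (initially $1$), with probability $1$ there is exactly one party $k$ with $y_k = 1$, and $y_i = 0$ for all other parties $i$. There are a single algorithm of this kind and an absolute constant $C$ such that for every $n \ge 1$, every connected simple graph $G$ with $n$ nodes and $m$ edges (unknown to the parties), and every port numbering of $G$, the algorithm, given $n$, exactly solves the leader election problem on $G$ in at most $C\,n$ rounds and with bit complexity at most $C\,m\,n^2$. -/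

import Mathlib

/-- A port numbering of a simple graph: at every node `v`, a bijection between the links incident
to `v` (given by the neighbours of `v`, as there are no multiple edges and no self-loops) and the
port labels `0, …, d_v - 1`. The bijections at distinct nodes are unrelated. -/
abbrev PortNumbering {V : Type} (G : SimpleGraph V) [∀ v, Fintype (G.neighborSet v)] : Type :=
  ∀ v : V, G.neighborSet v ≃ Fin (G.degree v)

namespace PortNumbering

variable {V : Type} {G : SimpleGraph V} [∀ v, Fintype (G.neighborSet v)]

/-- The other end of a link: if port `i` of `v` leads to `u`, then `⟨v, i⟩` is sent to `⟨u, j⟩`,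
where `j` is the port of `u` that leads to `v`. -/
def opposite (σ : PortNumbering G) (p : Σ v, Fin (G.degree v)) : Σ v, Fin (G.degree v) :=
  ⟨((σ p.1).symm p.2 : V), σ _ ⟨p.1, G.adj_symm ((σ p.1).symm p.2).2⟩⟩

theorem opposite_opposite (σ : PortNumbering G) (p : Σ v, Fin (G.degree v)) :
    opposite σ (opposite σ p) = p := by
  obtain ⟨v, i⟩ := p
  have key : ∀ (u : V) (w : G.neighborSet u),
      opposite σ ⟨u, σ u w⟩ = ⟨(w : V), σ w ⟨u, G.adj_symm w.2⟩⟩ := by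
    intro u w
    have h : ∀ x : G.neighborSet u, x = w →
        (⟨(x : V), σ x ⟨u, G.adj_symm x.2⟩⟩ : Σ v, Fin (G.degree v)) =
          ⟨(w : V), σ w ⟨u, G.adj_symm w.2⟩⟩ := by
      rintro x rfl
      rfl
    exact h _ ((σ u).symm_apply_apply w)
  have h1 : opposite σ ⟨v, i⟩ = ⟨((σ v).symm i : V), σ _ ⟨v, G.adj_symm ((σ v).symm i).2⟩⟩ := rfl
  rw [h1, key]
  exact congrArg (Sigma.mk v) ((σ v).apply_symm_apply i)

end PortNumbering

/-- The classical values of a message register: bit strings of length at most `B`. The empty string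
means that no message is sent. The register itself is the Hilbert space with these strings as
orthonormal basis, so that messages (and their lengths) may be in superposition. -/
abbrev Message (B : ℕ) : Type := Σ k : Fin (B + 1), (Fin (k : ℕ) → Bool)

namespace Message

/-- The number of bits of a message. -/
def length {B : ℕ} (μ : Message B) : ℕ := μ.1

/-- The empty message. -/
def empty {B : ℕ} : Message B := ⟨0, fun _ => false⟩

end Message

/-- The computational basis of the local system of a party with `d` ports: the bit `y` of the
leader election problem, a work register with basis `W`, and one message register per port. -/
abbrev LocalBasis (W : Type) (B d : ℕ) : Type := Bool × W × (Fin d → Message B)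

/-- A synchronous algorithm for anonymous quantum networks. Every party runs the same algorithm,
whose only arguments are the number `n` of parties and the number `d` of ports of the party. -/
structure AnonymousQuantumAlgorithm where
  /-- The basis of the work register. -/
  Work : ℕ → ℕ → Type
  [workFintype : ∀ n d, Fintype (Work n d)]
  [workDecidableEq : ∀ n d, DecidableEq (Work n d)]
  /-- The initial content of the work register. -/
  workInit : ∀ n d, Work n d
  /-- The capacity of a message register. -/
  capacity : ℕ → ℕ
  /-- The number of rounds. -/
  rounds : ℕ → ℕ
  /-- The local operation of round `t`, which takes the state of the party and the incoming
  messages (on the ports) to the new state and the outgoing messages (on the ports). For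
  `t = rounds n` it is the processing of the last incoming messages. -/
  op : ∀ n d : ℕ, ℕ → Matrix.unitaryGroup (LocalBasis (Work n d) (capacity n) d) ℂ

namespace AnonymousQuantumAlgorithm

attribute [instance] workFintype workDecidableEq

section Execution

variable (A : AnonymousQuantumAlgorithm) (n : ℕ) {V : Type}
  (G : SimpleGraph V) [∀ v, Fintype (G.neighborSet v)] (σ : PortNumbering G)

/-- The computational basis of the whole network. -/
abbrev GlobalBasis : Type :=
  ∀ v : V, LocalBasis (A.Work n (G.degree v)) (A.capacity n) (G.degree v)

/-- The initial basis state: every `y` is `1` and there are no messages. -/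
def initBasis : A.GlobalBasis n G :=
  fun v => (true, A.workInit n (G.degree v), fun _ => Message.empty)

variable {G}

/-- The transmission of all messages, on basis states: the message registers at the two ends of each
link are exchanged. -/
def deliver (b : A.GlobalBasis n G) : A.GlobalBasis n G :=
  fun v => ((b v).1, (b v).2.1, fun i =>
    (b (PortNumbering.opposite σ ⟨v, i⟩).1).2.2 (PortNumbering.opposite σ ⟨v, i⟩).2)

theorem deliver_involutive : Function.Involutive (A.deliver n σ) := by
  intro b
  funext v
  refine Prod.ext rfl (Prod.ext rfl ?_)
  funext i
  change (b (PortNumbering.opposite σ (PortNumbering.opposite σ ⟨v, i⟩)).1).2.2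
    (PortNumbering.opposite σ (PortNumbering.opposite σ ⟨v, i⟩)).2 = _
  rw [PortNumbering.opposite_opposite]

/-- The transmission of all messages, as a permutation of the basis. -/
def deliverPerm : Equiv.Perm (A.GlobalBasis n G) := (A.deliver_involutive n σ).toPerm

variable [Fintype V] [DecidableEq V] (G)

instance instDecidableEqGlobalBasis : DecidableEq (A.GlobalBasis n G) :=
  Fintype.decidablePiFintype

/-- The tensor product, over all parties, of their local operations of round `t`. -/
def globalOp (t : ℕ) : Matrix (A.GlobalBasis n G) (A.GlobalBasis n G) ℂ :=
  fun b' b => ∏ v, (A.op n (G.degree v) t).1 (b' v) (b v)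

variable {G}

/-- The state vector of the network after `t` rounds. A round consists of the local operations of all
parties, followed by the transmission of the messages. -/
noncomputable def state : ℕ → (A.GlobalBasis n G → ℂ)
  | 0 => Pi.single (A.initBasis n G) 1
  | t + 1 => fun b => (A.globalOp n G t).mulVec (state t) ((A.deliverPerm n σ).symm b)

/-- The state vector after the local operations that follow the first `t` rounds, with the outgoing
messages on the ports, before transmission. -/
noncomputable def preparedState (t : ℕ) : A.GlobalBasis n G → ℂ :=
  (A.globalOp n G t).mulVec (A.state n σ t)

open Classical in
/-- The number of qubits sent by party `v` through port `i` in round `t`: the largest length of the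
message there over all basis states with nonzero amplitude. -/
noncomputable def qubitsSent (t : ℕ) (v : V) (i : Fin (G.degree v)) : ℕ :=
  (Finset.univ.filter fun b : A.GlobalBasis n G => A.preparedState n σ t b ≠ 0).sup
    fun b => ((b v).2.2 i).length

/-- The total number of qubits sent over all links, in both directions and in all rounds. -/
noncomputable def bitComplexity : ℕ :=
  ∑ t ∈ Finset.range (A.rounds n), ∑ v : V, ∑ i : Fin (G.degree v), A.qubitsSent n σ t v i

/-- The final state vector: after all rounds, the last incoming messages are processed. -/
noncomputable def finalState : A.GlobalBasis n G → ℂ := A.preparedState n σ (A.rounds n)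

open Classical in
/-- The probability that, when all parties finally measure their bits `y` in the computational basis,
exactly one of these bits is `1`. -/
noncomputable def leaderProbability : ℝ :=
  ∑ b : A.GlobalBasis n G with ∃! v : V, (b v).1 = true, ‖A.finalState n σ b‖ ^ 2

end Execution

end AnonymousQuantumAlgorithm

/-! Every party puts its bit `y` in the state `c|0⟩ + s|1⟩`, with the coin tuned so that exactly one
candidate (`y = 1`) occurs with probability `1/4` (`exists_coin`). At this value a single step of
amplitude amplification reaches probability exactly `1` (`amplification`). That step needs two
reflections: a sign on the inputs with a unique candidate, and a sign on the all-zero input.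

Both are products of local phases, computed by one classical protocol. For `n` rounds the candidates
flood the network, and each recruited node remembers a parent port. For `n` more rounds every node
passes its tokens, initially one, to its parent. If a candidate exists, all tokens end at
candidates, so a candidate holds `n` tokens exactly when it is unique (`tokens_eq_iff`) and can
apply `-1` by itself. A node is unreached at the end only if there is no candidate at all. In that
case all `n` nodes are unreached, and phases `exp(iπ/n)` multiply to `-1` (`prod_silentPhase`).

The protocol runs reversibly, with the received messages kept as a history, and is run backwards
after each phase. The work and message registers then return to fixed values, and only amplitudes on
the bits `y` remain (`finalState_eq`). Token numbers travel in unary as message lengths, hence at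
most `n` qubits per message. There are four passes of `2n` rounds. -/

namespace LeaderElection

/-! ### The classical token-counting protocol -/

/-- A number, encoded as the length of a message. -/
def encode (B l : ℕ) : Message B := ⟨⟨min l B, by omega⟩, fun _ => false⟩

theorem length_encode (B l : ℕ) : (encode B l).length = min l B := rfl

/-- The classical state of a node with `d` ports: whether it is a candidate, the port that leads to
the node that has recruited it, and the number of tokens that it holds. -/
structure NodeState (d : ℕ) where
  isRoot : Bool
  parent : Option (Fin d)
  tokens : ℕ

namespace NodeState

variable {d : ℕ}

/-- The candidates, and the nodes recruited by other nodes. -/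
def Reached (s : NodeState d) : Prop := s.isRoot = true ∨ s.parent ≠ none

/-- A port through which a nonempty message has arrived. -/
noncomputable def activePort (m : Fin d → ℕ) : Option (Fin d) :=
  open Classical in if h : ∃ i, m i ≠ 0 then some h.choose else none

theorem ne_zero_of_activePort {m : Fin d → ℕ} {i : Fin d} (h : activePort m = some i) :
    m i ≠ 0 := by
  unfold activePort at h
  split_ifs at h with h'
  cases h
  exact h'.choose_spec

theorem activePort_ne_none {m : Fin d → ℕ} {i : Fin d} (h : m i ≠ 0) : activePort m ≠ none := by
  have h' : ∃ i, m i ≠ 0 := ⟨i, h⟩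
  simp [activePort, h']

/-- Every node starts with one token. -/
def init (d : ℕ) (y : Bool) : NodeState d := ⟨y, none, 1⟩

open Classical in
/-- The numbers sent in round `k`. In the first `n` rounds, the nodes reached so far recruit their
neighbours; later, all tokens are forwarded to the parent. -/
noncomputable def out (n k : ℕ) (s : NodeState d) (i : Fin d) : ℕ :=
  if k < n then (if s.Reached then 1 else 0) else if s.parent = some i then s.tokens else 0

open Classical in
/-- The transition at the end of round `k`. -/
noncomputable def step (n k : ℕ) (s : NodeState d) (m : Fin d → ℕ) : NodeState d :=
  if k < n then ⟨s.isRoot, if s.Reached then s.parent else activePort m, s.tokens⟩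
  else ⟨s.isRoot, s.parent, (if s.parent = none then s.tokens else 0) + ∑ i, m i⟩

/-- The message of round `k`. -/
noncomputable def send (n k : ℕ) (s : NodeState d) (i : Fin d) : Message n := encode n (s.out n k i)

theorem step_isRoot (n k : ℕ) (s : NodeState d) (m : Fin d → ℕ) :
    (s.step n k m).isRoot = s.isRoot := by
  unfold step; split_ifs <;> rfl

/-- Local conservation of tokens: a node with a parent sends everything through one port, a node
without one keeps everything. -/
theorem tokens_add_sum_out {n k : ℕ} (hk : n ≤ k) (s : NodeState d) :
    (if s.parent = none then s.tokens else 0) + ∑ i, s.out n k i = s.tokens := by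
  have hk' : ¬ k < n := by omega
  simp only [out, if_neg hk']
  cases h : s.parent with
  | none => simp
  | some j => simp

end NodeState

/-! ### Flooding, parent forest and token collection on a network. -/

section Network

variable {V : Type} {G : SimpleGraph V} [∀ v, Fintype (G.neighborSet v)] (σ : PortNumbering G)

/-- The opposite ports, as a permutation. -/
def oppositePerm : Equiv.Perm (Σ v, Fin (G.degree v)) :=
  Function.Involutive.toPerm (PortNumbering.opposite σ) (PortNumbering.opposite_opposite σ)

/-- The states of all nodes after `k` rounds, if the candidates are given by `x`. -/
noncomputable def net (n : ℕ) (x : V → Bool) : ℕ → ∀ v : V, NodeState (G.degree v)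
  | 0 => fun v => NodeState.init _ (x v)
  | k + 1 => fun v => (net n x k v).step n k fun i =>
      ((net n x k (PortNumbering.opposite σ ⟨v, i⟩).1).send n k
        (PortNumbering.opposite σ ⟨v, i⟩).2).length

variable {σ} {n : ℕ} {x : V → Bool}

theorem net_succ (k : ℕ) (v : V) : net σ n x (k + 1) v = (net σ n x k v).step n k fun i =>
    ((net σ n x k (PortNumbering.opposite σ ⟨v, i⟩).1).send n k
      (PortNumbering.opposite σ ⟨v, i⟩).2).length := rfl

theorem net_isRoot (k : ℕ) (v : V) : (net σ n x k v).isRoot = x v := by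
  induction k with
  | zero => rfl
  | succ k ih => rw [net_succ, NodeState.step_isRoot, ih]

theorem reached_succ_of_reached {k : ℕ} {v : V} (h : (net σ n x k v).Reached) :
    (net σ n x (k + 1) v).Reached ∧ (net σ n x (k + 1) v).parent = (net σ n x k v).parent := by
  have h' : (net σ n x (k + 1) v).parent = (net σ n x k v).parent := by
    rw [net_succ, NodeState.step]
    split_ifs <;> rfl
  refine ⟨?_, h'⟩
  unfold NodeState.Reached at h ⊢
  rwa [h', net_isRoot, ← net_isRoot (σ := σ) (n := n) (x := x) k v]

theorem reached_mono {k l : ℕ} (hkl : k ≤ l) {v : V} (h : (net σ n x k v).Reached) :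
    (net σ n x l v).Reached := by
  induction hkl with
  | refl => exact h
  | step _ ih => exact (reached_succ_of_reached ih).1

/-- Flooding advances one hop per round. The bound `1 ≤ n` keeps `encode` from truncating the
recruiting message to the empty one. -/
theorem reached_succ_of_adj (hn : 1 ≤ n) {k : ℕ} (hk : k < n) {u v : V} (ha : G.Adj v u)
    (h : (net σ n x k u).Reached) : (net σ n x (k + 1) v).Reached := by
  by_cases hv : (net σ n x k v).Reached
  · exact (reached_succ_of_reached hv).1
  · right
    rw [net_succ, NodeState.step, if_pos hk]
    simp only [if_neg hv]
    apply NodeState.activePort_ne_none (i := σ v ⟨u, ha⟩)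
    have h1 : (PortNumbering.opposite σ ⟨v, σ v ⟨u, ha⟩⟩).1 = u := by
      simp [PortNumbering.opposite]
    have h2 : (net σ n x k (PortNumbering.opposite σ ⟨v, σ v ⟨u, ha⟩⟩).1).Reached := by
      rw [h1]; exact h
    rw [NodeState.send, length_encode, NodeState.out, if_pos hk, if_pos h2]
    omega

theorem reached_of_walk (hn : 1 ≤ n) {v r : V} (p : G.Walk v r) (hr : x r = true)
    (hp : p.length ≤ n) : (net σ n x p.length v).Reached := by
  induction p with
  | nil => exact Or.inl hr
  | cons h p ih =>
    rw [SimpleGraph.Walk.length_cons] at hp ⊢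
    exact reached_succ_of_adj hn (by omega) h (ih hr (by omega))

/-- A parent is reached strictly earlier than its children. -/
theorem parent_reached {k : ℕ} {v : V} {i : Fin (G.degree v)}
    (h : (net σ n x k v).parent = some i) :
    ∃ j, ¬ (net σ n x j v).Reached ∧ (net σ n x j (PortNumbering.opposite σ ⟨v, i⟩).1).Reached := by
  induction k with
  | zero => cases h
  | succ k ih =>
    by_cases hv : (net σ n x k v).Reached
    · exact ih ((reached_succ_of_reached hv).2 ▸ h)
    · rw [net_succ, NodeState.step] at h
      by_cases hk : k < n
      · simp only [if_pos hk, if_neg hv] at h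
        have h0 := NodeState.ne_zero_of_activePort h
        refine ⟨k, hv, ?_⟩
        by_contra hu
        rw [NodeState.send, length_encode, NodeState.out, if_pos hk, if_neg hu] at h0
        omega
      · rw [if_neg hk] at h
        exact absurd (Or.inr (h ▸ Option.some_ne_none i)) hv

/-- The parent is fixed after `n` rounds. -/
theorem parent_eq {k : ℕ} (hk : n ≤ k) (v : V) :
    (net σ n x k v).parent = (net σ n x n v).parent := by
  induction k, hk using Nat.le_induction with
  | base => rfl
  | succ k hk ih => rw [net_succ, NodeState.step, if_neg (by omega)]; exact ih

theorem parent_root {v : V} (hv : x v = true) (k : ℕ) : (net σ n x k v).parent = none := by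
  induction k with
  | zero => rfl
  | succ k ih =>
    rw [(reached_succ_of_reached (Or.inl (by rw [net_isRoot, hv]))).2, ih]

/-- Without candidates every flooding message is empty, so no parent is ever chosen. -/
theorem not_reached (hx : ∀ v, x v = false) (k : ℕ) (v : V) : ¬ (net σ n x k v).Reached := by
  induction k generalizing v with
  | zero => simp [net, NodeState.Reached, NodeState.init, hx]
  | succ k ih =>
    rintro (h | h)
    · rw [net_isRoot, hx] at h; cases h
    · obtain ⟨i, hi⟩ := Option.ne_none_iff_exists'.1 h
      rw [net_succ, NodeState.step] at hi
      by_cases h1 : k < n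
      · simp only [if_pos h1, if_neg (ih v)] at hi
        have := NodeState.ne_zero_of_activePort hi
        rw [NodeState.send, length_encode, NodeState.out, if_pos h1, if_neg (ih _)] at this
        omega
      · rw [if_neg h1] at hi
        exact ih v (Or.inr (hi ▸ Option.some_ne_none i))

theorem tokens_of_le {k : ℕ} (hk : k ≤ n) (v : V) : (net σ n x k v).tokens = 1 := by
  induction k with
  | zero => rfl
  | succ k ih => rw [net_succ, NodeState.step, if_pos (by omega)]; exact ih (by omega)

/-- A candidate has no parent and so never gives away its own token. -/
theorem one_le_tokens {v : V} (hv : x v = true) (k : ℕ) : 1 ≤ (net σ n x k v).tokens := by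
  induction k with
  | zero => exact le_rfl
  | succ k ih =>
    rw [net_succ, NodeState.step]
    split_ifs with h1 h2
    · exact ih
    · exact ih
    · exact le_add_right ih
    · exact absurd (parent_root hv k) ‹_›

variable [Fintype V]

theorem sum_tokens (hV : Fintype.card V = n) (k : ℕ) : ∑ v, (net σ n x k v).tokens = n := by
  rcases le_total k n with hk | hk
  · simp [tokens_of_le hk, hV]
  · induction k, hk using Nat.le_induction with
    | base => simp [tokens_of_le le_rfl, hV]
    | succ k hk ih =>
      -- By the induction hypothesis a single message carries at most the `n` tokens in the network,
      -- so the cap in `encode` loses nothing.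
      have hout : ∀ p : Σ v, Fin (G.degree v), (net σ n x k p.1).out n k p.2 ≤ n := by
        intro p
        calc (net σ n x k p.1).out n k p.2 ≤ ∑ i, (net σ n x k p.1).out n k i :=
              Finset.single_le_sum (f := fun i => (net σ n x k p.1).out n k i)
                (fun _ _ => Nat.zero_le _) (Finset.mem_univ _)
          _ ≤ (net σ n x k p.1).tokens := by
              rw [← NodeState.tokens_add_sum_out hk (net σ n x k p.1)]; omega
          _ ≤ ∑ v, (net σ n x k v).tokens :=
              Finset.single_le_sum (f := fun v => (net σ n x k v).tokens)
                (fun _ _ => Nat.zero_le _) (Finset.mem_univ _)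
          _ = n := ih
      have hsend : ∀ p : Σ v, Fin (G.degree v), ((net σ n x k p.1).send n k p.2).length =
          (net σ n x k p.1).out n k p.2 := by
        intro p
        rw [NodeState.send, length_encode, min_eq_left (hout p)]
      -- Delivery permutes the ports, so the totals sent and received agree.
      have hperm : ∑ v, ∑ i, (net σ n x k (PortNumbering.opposite σ ⟨v, i⟩).1).out n k
            (PortNumbering.opposite σ ⟨v, i⟩).2 = ∑ v, ∑ i, (net σ n x k v).out n k i := by
        rw [← Fintype.sum_sigma' (fun v i => (net σ n x k v).out n k i),
          ← Fintype.sum_sigma' (fun v i => (net σ n x k (PortNumbering.opposite σ ⟨v, i⟩).1).out n k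
            (PortNumbering.opposite σ ⟨v, i⟩).2)]
        exact Equiv.sum_comp (oppositePerm σ) (fun p => (net σ n x k p.1).out n k p.2)
      have hstep : ∀ v, (net σ n x (k + 1) v).tokens =
          (if (net σ n x k v).parent = none then (net σ n x k v).tokens else 0) +
            ∑ i, (net σ n x k (PortNumbering.opposite σ ⟨v, i⟩).1).out n k
              (PortNumbering.opposite σ ⟨v, i⟩).2 := by
        intro v
        rw [net_succ, NodeState.step, if_neg (by omega)]
        simp only [hsend]
      simp only [hstep]
      rw [Finset.sum_add_distrib, hperm, ← Finset.sum_add_distrib]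
      simp only [NodeState.tokens_add_sum_out hk]
      exact ih

/-- In a connected network with a candidate, all nodes are reached. -/
theorem reached_of_connected (hV : Fintype.card V = n) (hG : G.Connected) {r : V}
    (hr : x r = true) (v : V) : (net σ n x (n - 1) v).Reached := by
  obtain ⟨p, hp⟩ := hG.preconnected.exists_isPath v r
  have h := hp.length_lt
  rw [hV] at h
  exact reached_mono (by omega) (reached_of_walk (by omega) p hr (by omega))

/-- At the end all tokens are held by candidates. -/
theorem tokens_eq_zero (hV : Fintype.card V = n) (hG : G.Connected) {r : V}
    (hr : x r = true) {v : V} (hv : x v = false) : (net σ n x (n + n) v).tokens = 0 := by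
  classical
  have hn : 1 ≤ n := by rw [← hV]; exact Fintype.card_pos_iff.2 ⟨r⟩
  have hex : ∀ v, ∃ k, (net σ n x k v).Reached := fun v => ⟨_, reached_of_connected hV hG hr v⟩
  -- The level is the first round at which a node is reached; it strictly decreases from child to
  -- parent.
  let lev : V → ℕ := fun v => Nat.find (hex v)
  have hlev : ∀ v, lev v < n := fun v =>
    lt_of_le_of_lt (Nat.find_min' (hex v) (reached_of_connected hV hG hr v)) (by omega)
  have hpar : ∀ k v i, (net σ n x k v).parent = some i →
      lev (PortNumbering.opposite σ ⟨v, i⟩).1 < lev v := by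
    intro k v i h
    obtain ⟨j, h1, h2⟩ := parent_reached h
    refine lt_of_le_of_lt (Nat.find_min' _ h2) ?_
    by_contra hlt
    exact h1 (reached_mono (not_lt.1 hlt) (Nat.find_spec (hex v)))
  -- Each forwarding round moves the tokens at least one level down. After `n` of them only nodes
  -- without a parent can hold any.
  have key : ∀ j ≤ n, ∀ v, (net σ n x (n + j) v).tokens ≠ 0 →
      (net σ n x (n + j) v).parent = none ∨ lev v + j < n := by
    intro j
    induction j with
    | zero => exact fun _ v _ => Or.inr (hlev v)
    | succ j ih =>
      intro hj v hv
      rw [parent_eq (by omega), ← parent_eq (k := n + j) (by omega)]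
      by_cases hp : (net σ n x (n + j) v).parent = none
      · exact Or.inl hp
      · right
        rw [← add_assoc, net_succ, NodeState.step, if_neg (by omega)] at hv
        simp only [if_neg hp, zero_add] at hv
        obtain ⟨i, -, hi⟩ := Finset.exists_ne_zero_of_sum_ne_zero hv
        -- The node of `q` sent tokens to `v`, so `v` is its parent and has a smaller level; the
        -- induction hypothesis applies to that node.
        generalize hq : PortNumbering.opposite σ ⟨v, i⟩ = q at hi
        have hq' : PortNumbering.opposite σ q = ⟨v, i⟩ := by
          rw [← hq, PortNumbering.opposite_opposite]
        rw [NodeState.send, length_encode, NodeState.out, if_neg (by omega)] at hi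
        split_ifs at hi with hqp
        · have h1 := hpar _ _ _ hqp
          rw [Sigma.eta, hq'] at h1
          rcases ih (by omega) q.1 (by omega) with h2 | h2
          · rw [hqp] at h2; cases h2
          · change lev v < lev q.1 at h1
            omega
        · omega
  by_contra h0
  rcases key n le_rfl v h0 with h | h
  · have hreach : (net σ n x (n + n) v).Reached :=
      reached_mono (by omega) (reached_of_connected hV hG hr v)
    rcases hreach with h1 | h1
    · rw [net_isRoot, hv] at h1; cases h1
    · exact h1 h
  · omega

/-- A candidate recognizes at the end whether it is the only one. -/
theorem tokens_eq_iff (hV : Fintype.card V = n) (hG : G.Connected) {r : V} (hr : x r = true) :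
    (net σ n x (n + n) r).tokens = n ↔ ∀ v, x v = true → v = r := by
  classical
  have hsum := sum_tokens (σ := σ) (x := x) hV (n + n)
  constructor
  · intro h v hv
    by_contra hne
    have h1 := one_le_tokens (σ := σ) (n := n) hv (n + n)
    -- A second candidate still holds a token, which leaves fewer than `n` for `r`.
    have h2 := Finset.sum_le_sum_of_subset (f := fun v => (net σ n x (n + n) v).tokens)
      (Finset.subset_univ {v, r})
    rw [Finset.sum_pair hne] at h2
    omega
  · intro h
    rw [Finset.sum_eq_single r] at hsum
    · exact hsum
    · intro v _ hv
      refine tokens_eq_zero hV hG hr ?_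
      by_contra h'
      exact hv (h v (by simpa using h'))
    · simp

end Network

/-! ### Tensor products of local operations -/

section Tensor

variable {V : Type} [Fintype V] {ι : V → Type}

/-- The tensor product of a family of matrices. -/
def tensor (u : ∀ v, Matrix (ι v) (ι v) ℂ) : Matrix (∀ v, ι v) (∀ v, ι v) ℂ :=
  fun b' b => ∏ v, u v (b' v) (b v)

theorem tensor_one [∀ v, DecidableEq (ι v)] : tensor (fun v => (1 : Matrix (ι v) (ι v) ℂ)) = 1 := by
  ext b' b
  simp only [tensor, Matrix.one_apply]
  rw [Finset.prod_ite_zero]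
  simp [funext_iff]

variable [DecidableEq V] [∀ v, Fintype (ι v)]

theorem tensor_mul (u w : ∀ v, Matrix (ι v) (ι v) ℂ) :
    tensor u * tensor w = tensor fun v => u v * w v := by
  ext b' b
  simp only [Matrix.mul_apply, tensor, Finset.prod_univ_sum, Fintype.piFinset_univ,
    Finset.prod_mul_distrib]

variable [∀ v, DecidableEq (ι v)]

variable {X : Type} [Fintype X]

/-- The vector with amplitude `a x` at the basis element `f x`. -/
noncomputable def embed {B : Type} [DecidableEq B] (f : X → B) (a : X → ℂ) : B → ℂ :=
  ∑ x, a x • Pi.single (f x) 1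

theorem embed_apply {B : Type} [DecidableEq B] (f : X → B) (a : X → ℂ) (b : B) :
    embed f a b = ∑ x, a x * (if b = f x then 1 else 0) := by
  simp only [embed, Finset.sum_apply, Pi.smul_apply, Pi.single_apply, smul_eq_mul]

theorem embed_apply_self {B : Type} [DecidableEq B] {f : X → B} (hf : Function.Injective f)
    (a : X → ℂ) (x : X) : embed f a (f x) = a x := by
  classical
  rw [embed_apply]
  simp [hf.eq_iff]

theorem embed_apply_of_notMem {B : Type} [DecidableEq B] {f : X → B} {b : B}
    (hb : b ∉ Set.range f) (a : X → ℂ) : embed f a b = 0 := by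
  rw [embed_apply]
  refine Finset.sum_eq_zero fun x _ => ?_
  rw [if_neg (fun h => hb ⟨x, h.symm⟩), mul_zero]

theorem mulVec_embed {B : Type} [Fintype B] [DecidableEq B] (M : Matrix B B ℂ) (f : X → B)
    (a : X → ℂ) (b : B) : (M.mulVec (embed f a)) b = ∑ x, a x * M b (f x) := by
  rw [embed, Matrix.mulVec_sum, Finset.sum_apply]
  refine Finset.sum_congr rfl fun x _ => ?_
  rw [Matrix.mulVec_smul, Matrix.mulVec_single_one]
  rfl

theorem embed_comp_perm {B : Type} [DecidableEq B] (e : Equiv.Perm B) (f : X → B) (a : X → ℂ) :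
    (fun b => embed f a (e.symm b)) = embed (fun x => e (f x)) a := by
  funext b
  simp only [embed_apply, Equiv.symm_apply_eq]

/-- A permutation of the basis. -/
def permUnitary {B : Type} [Fintype B] [DecidableEq B] (e : Equiv.Perm B) :
    Matrix.unitaryGroup B ℂ :=
  ⟨Matrix.of fun b' b => if b' = e b then 1 else 0, by
    rw [Matrix.mem_unitaryGroup_iff]
    ext b' b
    simp only [Matrix.mul_apply, Matrix.star_apply, Matrix.one_apply, Matrix.of_apply]
    rw [Finset.sum_eq_single (e.symm b')]
    · simp [eq_comm]
    · intro c _ hc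
      rw [if_neg, zero_mul]
      rintro rfl
      simp at hc
    · simp⟩

theorem permUnitary_one {B : Type} [Fintype B] [DecidableEq B] :
    (permUnitary (1 : Equiv.Perm B)).1 = 1 := by
  ext b' b
  rw [Matrix.one_apply]
  rfl

/-- A change of phases of the basis elements. -/
def phaseUnitary {B : Type} [Fintype B] [DecidableEq B] (z : B → Circle) :
    Matrix.unitaryGroup B ℂ :=
  ⟨Matrix.diagonal fun b => (z b : ℂ), by
    rw [Matrix.mem_unitaryGroup_iff, Matrix.star_eq_conjTranspose, Matrix.diagonal_conjTranspose,
      Matrix.diagonal_mul_diagonal, ← Matrix.diagonal_one]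
    congr 1
    funext b
    simp [Complex.mul_conj]⟩

/-- An operation on the first factor. -/
def firstUnitary {B R : Type} [Fintype B] [DecidableEq B] [Fintype R] [DecidableEq R]
    (K : Matrix.unitaryGroup B ℂ) : Matrix.unitaryGroup (B × R) ℂ :=
  ⟨Matrix.kronecker K.1 (1 : Matrix R R ℂ), Matrix.kronecker_mem_unitary K.2 (one_mem _)⟩

/-- Classical reversible steps move the basis labels and leave the amplitudes alone. -/
theorem tensor_perm (e : ∀ v, Equiv.Perm (ι v)) (f : X → ∀ v, ι v) (a : X → ℂ) :
    (tensor fun v => (permUnitary (e v)).1).mulVec (embed f a) =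
      embed (fun x v => e v (f x v)) a := by
  funext b
  rw [mulVec_embed, embed_apply]
  refine Finset.sum_congr rfl fun x _ => ?_
  congr 1
  simp only [tensor, permUnitary, Matrix.of_apply]
  rw [Finset.prod_ite_zero]
  simp [funext_iff]

/-- Local phases multiply to one global phase; this is how separate parties carry out a reflection
together. -/
theorem tensor_phase (z : ∀ v, ι v → Circle) (f : X → ∀ v, ι v) (a : X → ℂ) :
    (tensor fun v => (phaseUnitary (z v)).1).mulVec (embed f a) =
      embed f (fun x => (∏ v, (z v (f x v) : ℂ)) * a x) := by
  funext b
  rw [mulVec_embed, embed_apply]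
  refine Finset.sum_congr rfl fun x _ => ?_
  rw [mul_comm (∏ v, _) (a x), mul_assoc]
  congr 1
  simp only [tensor, phaseUnitary, Matrix.diagonal_apply]
  rw [Finset.prod_ite_zero]
  by_cases h : b = f x
  · subst h; simp
  · simp [h, ← funext_iff]

/-- The other registers hold `r`, independent of `x`, so the branches interfere as if only the bits
existed. This is what uncomputing the history is for. -/
theorem tensor_first {R : V → Type} [∀ v, Fintype (R v)] [∀ v, DecidableEq (R v)]
    (K : Matrix.unitaryGroup Bool ℂ) (r : ∀ v, R v) (a : (V → Bool) → ℂ) :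
    (tensor fun v => (firstUnitary (R := R v) K).1).mulVec (embed (fun x v => (x v, r v)) a) =
      embed (fun x v => (x v, r v)) ((tensor fun _ : V => K.1).mulVec a) := by
  have hinj : Function.Injective fun (x : V → Bool) v => (x v, r v) := by
    intro x y h
    funext v
    exact (Prod.ext_iff.1 (congrFun h v)).1
  funext b
  rw [mulVec_embed]
  by_cases hb : ∀ v, (b v).2 = r v
  · obtain ⟨y, rfl⟩ : ∃ y : V → Bool, b = fun v => (y v, r v) :=
      ⟨fun v => (b v).1, funext fun v => Prod.ext rfl (hb v)⟩
    rw [embed_apply_self hinj _ y, Matrix.mulVec, dotProduct]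
    refine Finset.sum_congr rfl fun x _ => ?_
    rw [mul_comm]
    simp [tensor, firstUnitary, Matrix.kroneckerMap_apply]
  · rw [embed_apply_of_notMem]
    · push Not at hb
      obtain ⟨v, hv⟩ := hb
      refine Finset.sum_eq_zero fun x _ => ?_
      rw [tensor, Finset.prod_eq_zero (Finset.mem_univ v), mul_zero]
      simp [firstUnitary, Matrix.kroneckerMap_apply, hv]
    · rintro ⟨x, rfl⟩
      exact hb fun v => rfl

end Tensor

/-! ### The reversible simulation of the classical protocol -/

/-- The work register holds the messages received in each round. -/
def History (n d : ℕ) : Type := Fin (n + n) → Fin d → Message n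

namespace History

variable {n d : ℕ}

instance instFintype : Fintype (History n d) :=
  inferInstanceAs (Fintype (Fin (n + n) → Fin d → Message n))

instance instDecidableEq : DecidableEq (History n d) :=
  inferInstanceAs (DecidableEq (Fin (n + n) → Fin d → Message n))

/-- The messages received in round `j`. -/
def get (w : History n d) (j : Fin (n + n)) : Fin d → Message n := w j

/-- Replacing the messages received in round `j`. -/
def set (w : History n d) (j : Fin (n + n)) (m : Fin d → Message n) : History n d :=
  Function.update (β := fun _ => Fin d → Message n) w j m

theorem ext {w w' : History n d} (h : ∀ j, w.get j = w'.get j) : w = w' := funext h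

theorem get_set_self (w : History n d) (j : Fin (n + n)) (m : Fin d → Message n) :
    (w.set j m).get j = m :=
  Function.update_self (β := fun _ => Fin d → Message n) j m w

theorem get_set_of_ne (w : History n d) {i j : Fin (n + n)} (h : i ≠ j) (m : Fin d → Message n) :
    (w.set j m).get i = w.get i :=
  Function.update_of_ne (β := fun _ => Fin d → Message n) h m w

theorem set_set_get (w : History n d) (j : Fin (n + n)) (m : Fin d → Message n) :
    (w.set j m).set j (w.get j) = w := by
  refine ext fun i => ?_
  by_cases h : i = j
  · subst h
    rw [get_set_self]
  · rw [get_set_of_ne _ h, get_set_of_ne _ h]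

end History

/-- The classical state before round `k` of a node with input `y` and history `w`. -/
noncomputable def localState {n d : ℕ} (y : Bool) (w : History n d) : ℕ → NodeState d
  | 0 => NodeState.init d y
  | k + 1 => (localState y w k).step n k fun i =>
      (if h : k < n + n then w.get ⟨k, h⟩ i else Message.empty).length

/-- The basis of the local system of a node with `d` ports. -/
abbrev PartyBasis (n d : ℕ) : Type := LocalBasis (History n d) n d

/-- Writing the messages of round `k` into empty message registers. -/
noncomputable def sendPerm (n d k : ℕ) : Equiv.Perm (PartyBasis n d) :=
  Function.Involutive.toPerm
    -- A swap with the empty messages is defined on every basis element and is its own inverse, so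
    -- the same permutation also erases the messages.
    (fun b => (b.1, b.2.1, Equiv.swap (fun _ => Message.empty)
      ((localState b.1 b.2.1 k).send n k) b.2.2))
    fun b => by simp

/-- Exchanging the message registers with the `k`-th entry of the history. -/
def receivePerm (n d k : ℕ) : Equiv.Perm (PartyBasis n d) :=
  Function.Involutive.toPerm
    (fun b => if h : k < n + n then (b.1, b.2.1.set ⟨k, h⟩ b.2.2, b.2.1.get ⟨k, h⟩) else b)
    fun b => by
      by_cases h : k < n + n <;> simp [h, History.set_set_get, History.get_set_self]

theorem sendPerm_sendPerm (n d k : ℕ) (b : PartyBasis n d) :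
    sendPerm n d k (sendPerm n d k b) = b :=
  Function.Involutive.toPerm_involutive _ b

theorem receivePerm_receivePerm (n d k : ℕ) (b : PartyBasis n d) :
    receivePerm n d k (receivePerm n d k b) = b :=
  Function.Involutive.toPerm_involutive _ b

/-- The operation on the bit `y` that prepares the initial superposition. -/
def biasMatrix (c s : ℝ) : Matrix Bool Bool ℂ := fun i j =>
  match i, j with
  | false, false => c
  | true, true => -c
  | _, _ => s

/-- The coin is a reflection, so one operation both prepares the superposition and undoes it. -/
theorem biasMatrix_mul_self {c s : ℝ} (h : c ^ 2 + s ^ 2 = 1) :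
    biasMatrix c s * biasMatrix c s = 1 := by
  have h' : (c : ℂ) ^ 2 + (s : ℂ) ^ 2 = 1 := by exact_mod_cast h
  ext i j
  rw [Matrix.mul_apply, Fintype.sum_bool]
  cases i <;> cases j <;> simp [biasMatrix] <;> grind

theorem star_biasMatrix (c s : ℝ) : star (biasMatrix c s) = biasMatrix c s := by
  ext i j
  rw [Matrix.star_apply]
  cases i <;> cases j <;> simp [biasMatrix]

/-- The biased coin. -/
def biasUnitary (c s : ℝ) (h : c ^ 2 + s ^ 2 = 1) : Matrix.unitaryGroup Bool ℂ :=
  ⟨biasMatrix c s, by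
    rw [Matrix.mem_unitaryGroup_iff, star_biasMatrix, biasMatrix_mul_self h]⟩

open Classical in
/-- A candidate that has collected all tokens changes the sign. -/
noncomputable def winnerPhase (n d : ℕ) (b : PartyBasis n d) : Circle :=
  if b.1 = true ∧ (localState b.1 b.2.1 (n + n)).tokens = n then Circle.exp Real.pi else 1

open Classical in
/-- If there is no candidate, all nodes together change the sign. -/
noncomputable def silentPhase (n d : ℕ) (b : PartyBasis n d) : Circle :=
  if (localState b.1 b.2.1 (n + n)).Reached then 1 else Circle.exp (Real.pi / n)

/-- Flipping the bit `y`. -/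
def flipPerm (n d : ℕ) : Equiv.Perm (PartyBasis n d) := Equiv.prodCongr Equiv.boolNot (Equiv.refl _)

/-- The operations between the passes of the protocol. There are four passes of `n + n` rounds;
the second and the fourth one are reversed. -/
noncomputable def midUnitary (K : Matrix.unitaryGroup Bool ℂ) (n d t : ℕ) :
    Matrix.unitaryGroup (PartyBasis n d) ℂ :=
  if t = 0 then firstUnitary K * permUnitary (flipPerm n d)
  else if t = n + n then phaseUnitary (winnerPhase n d)
  else if t = 2 * (n + n) then firstUnitary K
  else if t = 3 * (n + n) then phaseUnitary (silentPhase n d)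
  else if t = 4 * (n + n) then firstUnitary K
  else permUnitary 1

/-- The operation that precedes the transmission of round `t`. -/
noncomputable def beforePerm (n d t : ℕ) : Equiv.Perm (PartyBasis n d) :=
  -- The operation after the last round must not send. Odd passes traverse the protocol rounds in
  -- reverse order.
  if t < 4 * (n + n) then
    if t / (n + n) % 2 = 0 then sendPerm n d (t % (n + n))
    else receivePerm n d (n + n - 1 - t % (n + n))
  else 1

/-- The operation that follows the transmission of round `t`. -/
noncomputable def afterPerm (n d t : ℕ) : Equiv.Perm (PartyBasis n d) :=
  if t / (n + n) % 2 = 0 then receivePerm n d (t % (n + n))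
  else sendPerm n d (n + n - 1 - t % (n + n))

/-- The operation that processes the messages received before round `t`. -/
noncomputable def arrivePerm (n d : ℕ) : ℕ → Equiv.Perm (PartyBasis n d)
  | 0 => 1
  | t + 1 => afterPerm n d t

/-- The leader election algorithm, for given coins. -/
noncomputable def algorithm (K : ℕ → Matrix.unitaryGroup Bool ℂ) : AnonymousQuantumAlgorithm where
  Work := History
  workInit := fun _ _ _ _ => Message.empty
  capacity := fun n => n
  rounds := fun n => 4 * (n + n)
  op := fun n d t => permUnitary (beforePerm n d t) *
    midUnitary (K n) n d t * permUnitary (arrivePerm n d t)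

/-! ### Evolution of the quantum state through the four passes. -/

section Run

variable {V : Type} {G : SimpleGraph V} [∀ v, Fintype (G.neighborSet v)] (σ : PortNumbering G)
  (n : ℕ) (K : ℕ → Matrix.unitaryGroup Bool ℂ)

/-- The transmission of all messages. -/
def transmit : Equiv.Perm (∀ v : V, PartyBasis n (G.degree v)) :=
  Function.Involutive.toPerm (fun b v => ((b v).1, (b v).2.1, fun i =>
    (b (PortNumbering.opposite σ ⟨v, i⟩).1).2.2 (PortNumbering.opposite σ ⟨v, i⟩).2)) fun b => by
      funext v
      refine Prod.ext rfl (Prod.ext rfl ?_)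
      funext i
      change (b (PortNumbering.opposite σ (PortNumbering.opposite σ ⟨v, i⟩)).1).2.2
        (PortNumbering.opposite σ (PortNumbering.opposite σ ⟨v, i⟩)).2 = _
      rw [PortNumbering.opposite_opposite]

theorem transmit_apply (b : ∀ v : V, PartyBasis n (G.degree v)) (v : V) :
    transmit σ n b v = ((b v).1, (b v).2.1, fun i =>
      (b (PortNumbering.opposite σ ⟨v, i⟩).1).2.2 (PortNumbering.opposite σ ⟨v, i⟩).2) := rfl

theorem transmit_transmit (b : ∀ v : V, PartyBasis n (G.degree v)) :
    transmit σ n (transmit σ n b) = b :=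
  Function.Involutive.toPerm_involutive _ b

/-- The history of a node before round `k` of the protocol. -/
noncomputable def received (k : ℕ) (x : V → Bool) (v : V) : History n (G.degree v) :=
  fun j => if (j : ℕ) < k then fun i =>
      (net σ n x j (PortNumbering.opposite σ ⟨v, i⟩).1).send n j (PortNumbering.opposite σ ⟨v, i⟩).2
    else fun _ => Message.empty

theorem get_received (k : ℕ) (x : V → Bool) (v : V) (j : Fin (n + n)) :
    (received σ n k x v).get j = if (j : ℕ) < k then fun i =>
      (net σ n x j (PortNumbering.opposite σ ⟨v, i⟩).1).send n j (PortNumbering.opposite σ ⟨v, i⟩).2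
    else fun _ => Message.empty := rfl

/-- The basis element of the network before round `k` of the protocol. -/
noncomputable def config (k : ℕ) (x : V → Bool) (v : V) : PartyBasis n (G.degree v) :=
  (x v, received σ n k x v, fun _ => Message.empty)

variable {σ n}

theorem localState_config {k l : ℕ} (hkl : k ≤ l) (hk : k ≤ n + n) (x : V → Bool) (v : V) :
    localState (config σ n l x v).1 (config σ n l x v).2.1 k = net σ n x k v := by
  induction k with
  | zero => rfl
  | succ k ih =>
    rw [localState, ih (by omega) (by omega), net_succ]
    congr 1
    funext i
    have h1 : k < n + n := by omega
    have h2 : k < l := by omega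
    simp [config, get_received, h1, h2]

theorem sendPerm_config {k : ℕ} (hk : k < n + n) (x : V → Bool) (v : V) :
    sendPerm n (G.degree v) k (config σ n k x v) =
      ((config σ n k x v).1, (config σ n k x v).2.1, (net σ n x k v).send n k) := by
  rw [← localState_config le_rfl hk.le x v]
  change (_, _, Equiv.swap (fun _ => Message.empty) _ (fun _ => Message.empty)) = _
  rw [Equiv.swap_apply_left]

/-- One round of the protocol. -/
theorem round_config {k : ℕ} (hk : k < n + n) (x : V → Bool) (v : V) :
    receivePerm n (G.degree v) k (transmit σ n
      (fun v => sendPerm n (G.degree v) k (config σ n k x v)) v) = config σ n (k + 1) x v := by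
  simp only [sendPerm_config hk]
  change (if h : k < n + n then _ else _) = _
  rw [dif_pos hk]
  refine Prod.ext rfl (Prod.ext ?_ ?_)
  · refine History.ext fun j => ?_
    by_cases hj : j = ⟨k, hk⟩
    · subst hj
      simp [transmit_apply, config, History.get_set_self, get_received]
    · have h : (j : ℕ) ≠ k := fun h => hj (Fin.ext h)
      have h' : (j : ℕ) < k + 1 ↔ (j : ℕ) < k := by omega
      simp only [transmit_apply, config, History.get_set_of_ne _ hj, get_received, h']
  · simp [transmit_apply, config, get_received]

/-- One round of the protocol, reversed. -/
theorem reverse_round_config {k : ℕ} (hk : k < n + n) (x : V → Bool) (v : V) :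
    sendPerm n (G.degree v) k (transmit σ n
      (fun v => receivePerm n (G.degree v) k (config σ n (k + 1) x v)) v) = config σ n k x v := by
  simp only [← round_config hk, receivePerm_receivePerm]
  rw [transmit_transmit, sendPerm_sendPerm]

theorem config_zero : config σ n 0 = fun (x : V → Bool) v =>
    (x v, (((fun _ _ => Message.empty : Fin (n + n) → Fin (G.degree v) → Message n),
      fun _ => Message.empty) :
      History n (G.degree v) × (Fin (G.degree v) → Message n))) := by
  funext x v
  simp only [config]
  refine Prod.ext rfl (Prod.ext (History.ext fun j => ?_) rfl)
  rw [get_received, if_neg (Nat.not_lt_zero _)]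
  rfl

theorem config_zero_injective : Function.Injective (config σ n 0) := by
  intro x y h
  funext v
  exact congrArg Prod.fst (congrFun h v)

variable [Fintype V] [DecidableEq V]

instance instDecidableEqNetwork : DecidableEq (∀ v : V, PartyBasis n (G.degree v)) :=
  Fintype.decidablePiFintype

variable (σ n)

/-- The state before the middle operation of round `t`. -/
noncomputable def arrived : ℕ → (∀ v : V, PartyBasis n (G.degree v)) → ℂ
  | 0 => Pi.single (fun v => flipPerm n (G.degree v) (config σ n 0 (fun _ => false) v)) 1
  | t + 1 => (tensor fun v => (permUnitary (afterPerm n (G.degree v) t)).1).mulVec fun b =>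
      (tensor fun v => (permUnitary (beforePerm n (G.degree v) t)).1).mulVec
        ((tensor fun v => (midUnitary (K n) n (G.degree v) t).1).mulVec (arrived t))
          ((transmit σ n).symm b)

/-- The state after the middle operation of round `t`. -/
noncomputable def processed (t : ℕ) : (∀ v : V, PartyBasis n (G.degree v)) → ℂ :=
  (tensor fun v => (midUnitary (K n) n (G.degree v) t).1).mulVec (arrived σ n K t)

theorem preparedState_eq_mulVec (t : ℕ) : (algorithm K).preparedState n σ t =
    (tensor fun v => (permUnitary (beforePerm n (G.degree v) t)).1).mulVec
      ((tensor fun v => (midUnitary (K n) n (G.degree v) t).1).mulVec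
        ((tensor fun v => (permUnitary (arrivePerm n (G.degree v) t)).1).mulVec
          ((algorithm K).state n σ t))) := by
  have key : ∀ φ : (∀ v : V, PartyBasis n (G.degree v)) → ℂ,
      (tensor fun v => (permUnitary (beforePerm n (G.degree v) t) *
        midUnitary (K n) n (G.degree v) t * permUnitary (arrivePerm n (G.degree v) t)).1).mulVec φ =
      (tensor fun v => (permUnitary (beforePerm n (G.degree v) t)).1).mulVec
        ((tensor fun v => (midUnitary (K n) n (G.degree v) t).1).mulVec
          ((tensor fun v => (permUnitary (arrivePerm n (G.degree v) t)).1).mulVec φ)) := by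
    intro φ
    rw [Matrix.mulVec_mulVec, Matrix.mulVec_mulVec, tensor_mul, tensor_mul]
    rfl
  exact key _

/-- Shifts the round boundary: the processing of incoming messages is counted with the preceding
transmission, so that a whole protocol round lies between two middle operations. -/
theorem mulVec_state (t : ℕ) :
    (tensor fun v => (permUnitary (arrivePerm n (G.degree v) t)).1).mulVec
      ((algorithm K).state n σ t) = arrived σ n K t := by
  induction t with
  | zero =>
    have h : (algorithm K).initBasis n G =
        fun v => flipPerm n (G.degree v) (config σ n 0 (fun _ => false) v) := by
      rw [config_zero]; rfl
    rw [arrived, ← h]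
    simp only [arrivePerm, permUnitary_one]
    rw [tensor_one]
    exact Matrix.one_mulVec _
  | succ t ih =>
    have h : (algorithm K).state n σ (t + 1) =
        fun b => (algorithm K).preparedState n σ t ((transmit σ n).symm b) := rfl
    rw [h, preparedState_eq_mulVec, ih]
    rfl

theorem preparedState_eq (t : ℕ) : (algorithm K).preparedState n σ t =
    (tensor fun v => (permUnitary (beforePerm n (G.degree v) t)).1).mulVec (processed σ n K t) := by
  rw [preparedState_eq_mulVec, mulVec_state, processed]

variable {σ n K}

theorem arrived_succ {t : ℕ} {f : (V → Bool) → ∀ v, PartyBasis n (G.degree v)}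
    {a : (V → Bool) → ℂ} (h : processed σ n K t = embed f a) :
    arrived σ n K (t + 1) = embed (fun x v => afterPerm n (G.degree v) t
      (transmit σ n (fun v => beforePerm n (G.degree v) t (f x v)) v)) a := by
  rw [processed] at h
  rw [arrived, h, tensor_perm, embed_comp_perm, tensor_perm]

theorem arrived_forward {q k : ℕ} (hq : q % 2 = 0) (hq' : q < 4) (hk : k < n + n)
    {a : (V → Bool) → ℂ} (h : processed σ n K (q * (n + n) + k) = embed (config σ n k) a) :
    arrived σ n K (q * (n + n) + k + 1) = embed (config σ n (k + 1)) a := by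
  have h1 : (q * (n + n) + k) / (n + n) = q := by
    rw [mul_comm, Nat.mul_add_div (by omega), Nat.div_eq_of_lt hk, add_zero]
  have h2 : (q * (n + n) + k) % (n + n) = k := by
    rw [mul_comm, Nat.mul_add_mod, Nat.mod_eq_of_lt hk]
  have h3 : q * (n + n) + k < 4 * (n + n) := by nlinarith
  rw [arrived_succ h]
  congr 1
  funext x v
  simp only [afterPerm, beforePerm, h1, h2, hq, if_pos h3, if_true]
  exact round_config hk x v

theorem arrived_backward {q k : ℕ} (hq : q % 2 = 1) (hq' : q < 4) (hk : k < n + n)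
    {a : (V → Bool) → ℂ}
    (h : processed σ n K (q * (n + n) + k) = embed (config σ n (n + n - k)) a) :
    arrived σ n K (q * (n + n) + k + 1) = embed (config σ n (n + n - (k + 1))) a := by
  have h1 : (q * (n + n) + k) / (n + n) = q := by
    rw [mul_comm, Nat.mul_add_div (by omega), Nat.div_eq_of_lt hk, add_zero]
  have h2 : (q * (n + n) + k) % (n + n) = k := by
    rw [mul_comm, Nat.mul_add_mod, Nat.mod_eq_of_lt hk]
  have h3 : q * (n + n) + k < 4 * (n + n) := by nlinarith
  -- Step `k` of a backward pass undoes protocol round `n + n - 1 - k`.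
  have h4 : n + n - k = n + n - 1 - k + 1 := by omega
  have h5 : n + n - (k + 1) = n + n - 1 - k := by omega
  rw [arrived_succ h]
  congr 1
  funext x v
  simp only [afterPerm, beforePerm, h1, h2, hq, if_pos h3, one_ne_zero, if_false, h4, h5]
  exact reverse_round_config (by omega) x v

theorem midUnitary_eq_one {q k : ℕ} (hk0 : 0 < k) (hk : k < n + n) (d : ℕ) :
    midUnitary (K n) n d (q * (n + n) + k) = permUnitary 1 := by
  have h2 : ∀ p, q * (n + n) + k ≠ p * (n + n) := by
    intro p hp
    have h := congrArg (· % (n + n)) hp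
    simp only [mul_comm _ (n + n), Nat.mul_add_mod, Nat.mul_mod_right, Nat.mod_eq_of_lt hk] at h
    omega
  have h0 := h2 0
  have h1 := h2 1
  rw [zero_mul] at h0
  rw [one_mul] at h1
  rw [midUnitary, if_neg h0, if_neg h1, if_neg (h2 2), if_neg (h2 3), if_neg (h2 4)]

theorem processed_eq_arrived {q k : ℕ} (hk0 : 0 < k) (hk : k < n + n)
    {f : (V → Bool) → ∀ v, PartyBasis n (G.degree v)} {a : (V → Bool) → ℂ}
    (h : arrived σ n K (q * (n + n) + k) = embed f a) :
    processed σ n K (q * (n + n) + k) = embed f a := by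
  rw [processed, h]
  simp only [midUnitary_eq_one hk0 hk]
  exact tensor_perm _ _ _

theorem forward_pass {q : ℕ} (hq : q % 2 = 0) (hq' : q < 4) (hn : 0 < n) {a : (V → Bool) → ℂ}
    (h : processed σ n K (q * (n + n)) = embed (config σ n 0) a) :
    arrived σ n K ((q + 1) * (n + n)) = embed (config σ n (n + n)) a := by
  have key : ∀ k < n + n, arrived σ n K (q * (n + n) + k + 1) = embed (config σ n (k + 1)) a := by
    intro k
    induction k with
    | zero => exact fun hk => arrived_forward hq hq' hk h
    | succ k ih =>
      intro hk
      exact arrived_forward hq hq' hk (processed_eq_arrived (by omega) hk (ih (by omega)))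
  have h1 := key (n + n - 1) (by omega)
  have h2 : n + n - 1 + 1 = n + n := by omega
  rwa [add_assoc, h2, ← Nat.succ_mul] at h1

theorem backward_pass {q : ℕ} (hq : q % 2 = 1) (hq' : q < 4) (hn : 0 < n) {a : (V → Bool) → ℂ}
    (h : processed σ n K (q * (n + n)) = embed (config σ n (n + n)) a) :
    arrived σ n K ((q + 1) * (n + n)) = embed (config σ n 0) a := by
  have key : ∀ k < n + n,
      arrived σ n K (q * (n + n) + k + 1) = embed (config σ n (n + n - (k + 1))) a := by
    intro k
    induction k with
    | zero => exact fun hk => arrived_backward hq hq' hk h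
    | succ k ih =>
      intro hk
      exact arrived_backward hq hq' hk (processed_eq_arrived (by omega) hk (ih (by omega)))
  have h1 := key (n + n - 1) (by omega)
  have h2 : n + n - 1 + 1 = n + n := by omega
  rwa [add_assoc, h2, ← Nat.succ_mul, Nat.sub_self] at h1

theorem tensor_first_config (a : (V → Bool) → ℂ) :
    (tensor fun v => (firstUnitary (K n) : Matrix.unitaryGroup (PartyBasis n (G.degree v)) ℂ).1).mulVec
      (embed (config σ n 0) a) =
      embed (config σ n 0) ((tensor fun _ : V => (K n).1).mulVec a) := by
  rw [config_zero]
  exact tensor_first _ _ _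

/-- The bits start as `true`; the flip in the first middle operation resets them to `false`, the
base point of the amplification. -/
theorem processed_zero : processed σ n K 0 = embed (config σ n 0)
    ((tensor fun _ : V => (K n).1).mulVec (Pi.single (fun _ => false) 1)) := by
  have h1 : arrived σ n K 0 = embed (fun x v => flipPerm n (G.degree v) (config σ n 0 x v))
      (Pi.single (fun _ => false) 1) := by
    rw [arrived, embed, Finset.sum_eq_single (fun _ => false) (fun x _ hx => by simp [hx])
      (by simp), Pi.single_eq_same, one_smul]
  have hflip : ∀ (v : V) (b : PartyBasis n (G.degree v)),
      flipPerm n (G.degree v) (flipPerm n (G.degree v) b) = b := by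
    rintro v ⟨y, w⟩
    simp [flipPerm]
  rw [processed, h1]
  have hmid : ∀ v, (midUnitary (K n) n (G.degree v) 0).1 =
      (firstUnitary (K n) : Matrix.unitaryGroup (PartyBasis n (G.degree v)) ℂ).1 *
        (permUnitary (flipPerm n (G.degree v))).1 := fun v => rfl
  simp only [hmid]
  rw [← tensor_mul, ← Matrix.mulVec_mulVec, tensor_perm]
  simp only [hflip]
  exact tensor_first_config _

theorem processed_phase {t : ℕ} {z : ∀ d, PartyBasis n d → Circle}
    (hz : ∀ d, midUnitary (K n) n d t = phaseUnitary (z d))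
    {f : (V → Bool) → ∀ v, PartyBasis n (G.degree v)} {a : (V → Bool) → ℂ}
    (h : arrived σ n K t = embed f a) :
    processed σ n K t = embed f fun x => (∏ v, (z (G.degree v) (f x v) : ℂ)) * a x := by
  rw [processed, h]
  simp only [hz]
  exact tensor_phase _ _ _

theorem processed_first {t : ℕ} (ht : ∀ d, midUnitary (K n) n d t = firstUnitary (K n))
    {a : (V → Bool) → ℂ} (h : arrived σ n K t = embed (config σ n 0) a) :
    processed σ n K t = embed (config σ n 0) ((tensor fun _ : V => (K n).1).mulVec a) := by
  rw [processed, h]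
  simp only [ht]
  exact tensor_first_config _

/-- The evolution of the amplitudes of the bits `y` under the whole algorithm. -/
theorem finalState_eq (hn : 0 < n) : (algorithm K).finalState n σ = embed (config σ n 0)
    ((tensor fun _ : V => (K n).1).mulVec fun x =>
      (∏ v, (silentPhase n (G.degree v) (config σ n (n + n) x v) : ℂ)) *
      (tensor fun _ : V => (K n).1).mulVec (fun x =>
        (∏ v, (winnerPhase n (G.degree v) (config σ n (n + n) x v) : ℂ)) *
        (tensor fun _ : V => (K n).1).mulVec (Pi.single (fun _ => false) 1) x) x) := by
  have m1 : ∀ d, midUnitary (K n) n d (1 * (n + n)) = phaseUnitary (winnerPhase n d) := by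
    intro d
    rw [midUnitary, if_neg (by omega), if_pos (by omega)]
  have m2 : ∀ d, midUnitary (K n) n d (2 * (n + n)) = firstUnitary (K n) := by
    intro d
    rw [midUnitary, if_neg (by omega), if_neg (by omega), if_pos rfl]
  have m3 : ∀ d, midUnitary (K n) n d (3 * (n + n)) = phaseUnitary (silentPhase n d) := by
    intro d
    rw [midUnitary, if_neg (by omega), if_neg (by omega), if_neg (by omega), if_pos rfl]
  have m4 : ∀ d, midUnitary (K n) n d (4 * (n + n)) = firstUnitary (K n) := by
    intro d
    rw [midUnitary, if_neg (by omega), if_neg (by omega), if_neg (by omega), if_neg (by omega),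
      if_pos rfl]
  have h1 := forward_pass (q := 0) (σ := σ) (K := K) rfl (by omega) hn
    (by rw [zero_mul]; exact processed_zero)
  rw [zero_add] at h1
  have h2 := backward_pass (q := 1) rfl (by omega) hn (processed_phase m1 h1)
  have h3 := forward_pass (q := 2) rfl (by omega) hn (processed_first m2 h2)
  have h4 := processed_first m4 (backward_pass (q := 3) rfl (by omega) hn (processed_phase m3 h3))
  have hb : ∀ d, beforePerm n d (4 * (n + n)) = 1 := by
    intro d
    rw [beforePerm, if_neg (lt_irrefl _)]
  refine (preparedState_eq σ n K (4 * (n + n))).trans ?_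
  rw [h4]
  simp only [hb]
  exact tensor_perm _ _ _

end Run

/-! ### Amplitude amplification -/

/-- One step of amplitude amplification, from success probability `1 / 4` to success
probability `1`. -/
theorem amplification {X : Type} [Fintype X] [DecidableEq X] {M : Matrix X X ℂ} (hM : M * M = 1)
    (hsymm : M.transpose = M) (z : X) (g : X → Prop) [DecidablePred g]
    (hg : ∑ x with g x, M x z ^ 2 = 1 / 4) :
    (M.mulVec fun x => (if x = z then -1 else 1) * M.mulVec (fun x => (if g x then -1 else 1) *
      M.mulVec (Pi.single z 1) x) x) = fun x => if g x then -2 * M x z else 0 := by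
  have hψ : ∀ x, M.mulVec (Pi.single z 1) x = M x z := by
    intro x
    rw [Matrix.mulVec_single_one]; rfl
  simp only [hψ]
  -- Symmetry together with `M * M = 1` normalises the column of `z` in plain squares, without
  -- conjugation.
  have hzx : ∀ x, M z x = M x z := fun x => congrFun (congrFun hsymm x) z
  have h1 : ∑ x, M x z ^ 2 = 1 := by
    have h := congrFun (congrFun hM z) z
    rw [Matrix.mul_apply, Matrix.one_apply_eq] at h
    rw [← h]
    exact Finset.sum_congr rfl fun x _ => by rw [hzx, sq]
  set a : X → ℂ := fun x => (if g x then -1 else 1) * M x z with ha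
  -- Changing the sign of weight `1/4` gives overlap `1 - 2 * (1/4)` with the original vector.
  have h2 : M.mulVec a z = 1 / 2 := by
    have h3 : ∀ x, M z x * a x = M x z ^ 2 - 2 * (if g x then M x z ^ 2 else 0) := by
      intro x
      rw [ha, hzx]
      dsimp only
      split_ifs <;> ring
    rw [Matrix.mulVec, dotProduct, Finset.sum_congr rfl fun x _ => h3 x, Finset.sum_sub_distrib,
      h1, ← Finset.mul_sum, ← Finset.sum_filter, hg]
    norm_num
  -- Negating the entry `1/2` at `z` amounts to subtracting `1` there. Applying `M` then gives `a`
  -- minus the column of `z`, which cancels off the good set and doubles on it.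
  have h4 : (fun x => (if x = z then -1 else 1) * M.mulVec a x) =
      M.mulVec a - Pi.single z 1 := by
    funext x
    rw [Pi.sub_apply, Pi.single_apply]
    split_ifs with h
    · rw [h, h2]; norm_num
    · ring
  rw [h4, Matrix.mulVec_sub, Matrix.mulVec_mulVec, hM, Matrix.one_mulVec]
  funext x
  rw [Pi.sub_apply, hψ, ha]
  dsimp only
  split_ifs <;> ring

/-- With candidate probability `1/n`, exactly one candidate has probability `(1 - 1/n)^(n-1)`. With
`m = n - 1` this is the inverse of `(1 + 1/m)^m ≤ e < 4`. -/
theorem one_div_four_le_pow {n : ℕ} (hn : 0 < n) :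
    (1 : ℝ) / 4 ≤ (1 - 1 / (n : ℝ)) ^ (n - 1) := by
  obtain ⟨m, rfl⟩ : ∃ m, n = m + 1 := ⟨n - 1, by omega⟩
  rw [Nat.add_sub_cancel]
  rcases Nat.eq_zero_or_pos m with rfl | hm
  · norm_num
  have hm' : (0 : ℝ) < m := Nat.cast_pos.2 hm
  have h1 : (1 - 1 / ((m + 1 : ℕ) : ℝ)) = (1 + 1 / (m : ℝ))⁻¹ := by
    push_cast
    field_simp
    ring
  have h2 : (1 + 1 / (m : ℝ)) ^ m ≤ 4 := by
    have h3 : 1 + 1 / (m : ℝ) ≤ Real.exp (1 / m) := by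
      rw [add_comm]; exact Real.add_one_le_exp _
    calc (1 + 1 / (m : ℝ)) ^ m ≤ Real.exp (1 / m) ^ m := pow_le_pow_left₀ (by positivity) h3 m
      _ = Real.exp 1 := by
        rw [← Real.exp_nat_mul]
        congr 1
        field_simp
      _ ≤ 4 := by linarith [Real.exp_one_lt_d9]
  rw [h1, inv_pow, one_div]
  exact inv_anti₀ (by positivity) h2

/-- Coins that make the success probability equal to `1 / 4`. -/
theorem exists_coin (n : ℕ) : ∃ c s : ℝ, c ^ 2 + s ^ 2 = 1 ∧
    (0 < n → n * (s ^ 2 * (c ^ 2) ^ (n - 1)) = 1 / 4) := by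
  rcases Nat.eq_zero_or_pos n with rfl | hn
  · exact ⟨1, 0, by norm_num, fun h => absurd h (lt_irrefl _)⟩
  have hn' : (0 : ℝ) < n := Nat.cast_pos.2 hn
  have hn1 : (1 : ℝ) ≤ n := Nat.one_le_cast.2 hn
  have hcont : ContinuousOn (fun p : ℝ => n * (p * (1 - p) ^ (n - 1))) (Set.Icc 0 (1 / n)) := by
    fun_prop
  have hmem : (1 / 4 : ℝ) ∈ Set.Icc ((n : ℝ) * (0 * (1 - 0) ^ (n - 1)))
      (n * (1 / n * (1 - 1 / (n : ℝ)) ^ (n - 1))) := by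
    refine ⟨by norm_num, ?_⟩
    rw [← mul_assoc, mul_one_div_cancel hn'.ne', one_mul]
    exact one_div_four_le_pow hn
  -- The success probability is `0` at `p = 0` and at least `1/4` at `p = 1/n`.
  obtain ⟨p, ⟨hp0, hp1⟩, hp⟩ := intermediate_value_Icc (by positivity) hcont hmem
  have hp2 : p ≤ 1 := hp1.trans ((div_le_one hn').2 hn1)
  refine ⟨√(1 - p), √p, ?_, fun _ => ?_⟩
  · rw [Real.sq_sqrt hp0, Real.sq_sqrt (by linarith)]; ring
  · rw [Real.sq_sqrt hp0, Real.sq_sqrt (by linarith)]; exact hp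

/-! ### Success probability, global phases and communication cost. -/

section Amplitudes

theorem coe_biasUnitary {c s : ℝ} (h : c ^ 2 + s ^ 2 = 1) :
    (biasUnitary c s h).1 = biasMatrix c s := rfl

variable {V : Type} [Fintype V]

/-- The amplitude of `x` in the initial superposition. -/
theorem tensor_biasMatrix_apply (c s : ℝ) (x : V → Bool) :
    tensor (fun _ : V => biasMatrix c s) x (fun _ => false) =
      ((∏ v, if x v = true then s else c : ℝ) : ℂ) := by
  rw [tensor, Complex.ofReal_prod]
  refine Finset.prod_congr rfl fun v _ => ?_
  cases x v <;> simp [biasMatrix]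

theorem transpose_tensor_biasMatrix (c s : ℝ) :
    (tensor (fun _ : V => biasMatrix c s)).transpose = tensor (fun _ : V => biasMatrix c s) := by
  ext x y
  rw [Matrix.transpose_apply, tensor, tensor]
  refine Finset.prod_congr rfl fun v _ => ?_
  cases x v <;> cases y v <;> rfl

variable [DecidableEq V]

theorem tensor_biasMatrix_mul_self {c s : ℝ} (h : c ^ 2 + s ^ 2 = 1) :
    tensor (fun _ : V => biasMatrix c s) * tensor (fun _ : V => biasMatrix c s) = 1 := by
  rw [tensor_mul, biasMatrix_mul_self h, tensor_one]

open Classical in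
/-- The probability that there is exactly one candidate. -/
theorem sum_unique_candidate (c s : ℝ) :
    ∑ x : V → Bool with ∃! v, x v = true, (∏ v, if x v = true then s else c) ^ 2 =
      Fintype.card V * (s ^ 2 * (c ^ 2) ^ (Fintype.card V - 1)) := by
  rw [← nsmul_eq_mul, ← Finset.card_univ, ← Finset.sum_const]
  symm
  -- Inputs with a unique candidate are the indicators of single nodes, all of equal weight.
  refine Finset.sum_of_injOn (fun (v w : V) => decide (w = v)) ?_ ?_ ?_ ?_
  · intro v _ w _ h
    simpa using congrFun h v
  · intro v _
    simp only [Finset.coe_filter, Finset.mem_univ, true_and, Set.mem_ofPred_eq]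
    exact ⟨v, by simp, fun w hw => by simpa using hw⟩
  · intro x hx hx'
    exfalso
    obtain ⟨v, hv, huniq⟩ := (Finset.mem_filter.1 hx).2
    refine hx' ⟨v, by simp, ?_⟩
    funext w
    by_cases hw : w = v
    · subst hw; simp [hv]
    · have : x w ≠ true := fun h => hw (huniq w h)
      simp [hw, this]
  · intro v _
    rw [← Finset.mul_prod_erase _ _ (Finset.mem_univ v)]
    have h : ∏ w ∈ Finset.univ.erase v, (if decide (w = v) = true then s else c) =
        c ^ (Fintype.card V - 1) := by
      rw [Finset.prod_congr rfl (g := fun _ => c), Finset.prod_const,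
        Finset.card_erase_of_mem (Finset.mem_univ v), Finset.card_univ]
      intro w hw
      simp [Finset.ne_of_mem_erase hw]
    rw [h]
    simp only [decide_true, if_true, Finset.card_univ]
    ring

variable {G : SimpleGraph V} [∀ v, Fintype (G.neighborSet v)] {σ : PortNumbering G} {n : ℕ}

open Classical in
-- Only a unique candidate contributes a factor different from `1`, so the sign is applied at most
-- once.
theorem prod_winnerPhase (hV : Fintype.card V = n) (hG : G.Connected) (x : V → Bool) :
    ∏ v, (winnerPhase n (G.degree v) (config σ n (n + n) x v) : ℂ) =
      if ∃! v, x v = true then -1 else 1 := by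
  have key : ∀ v, (winnerPhase n (G.degree v) (config σ n (n + n) x v) : ℂ) =
      if x v = true ∧ ∀ w, x w = true → w = v then -1 else 1 := by
    intro v
    have hx : (config σ n (n + n) x v).1 = x v := rfl
    have hiff : (x v = true ∧ (net σ n x (n + n) v).tokens = n) ↔
        (x v = true ∧ ∀ w, x w = true → w = v) :=
      and_congr_right fun hv => tokens_eq_iff hV hG hv
    rw [winnerPhase, localState_config le_rfl le_rfl, hx]
    simp only [hiff]
    split_ifs
    · rw [Circle.coe_exp, Complex.exp_pi_mul_I]
    · rfl
  simp only [key]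
  split_ifs with h
  · obtain ⟨r, hr, huniq⟩ := h
    rw [Finset.prod_eq_single r]
    · rw [if_pos ⟨hr, huniq⟩]
    · intro v _ hv
      rw [if_neg fun h => hv (huniq v h.1)]
    · simp
  · refine Finset.prod_eq_one fun v _ => ?_
    rw [if_neg fun h' => h ⟨v, h'⟩]

open Classical in
-- By connectedness either all nodes are reached or none is, so the product is `1` or `exp(iπ/n)^n`.
theorem prod_silentPhase (hV : Fintype.card V = n) (hG : G.Connected) (x : V → Bool) :
    ∏ v, (silentPhase n (G.degree v) (config σ n (n + n) x v) : ℂ) =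
      if x = fun _ => false then -1 else 1 := by
  have hn : 0 < n := by
    have := hG.nonempty
    rw [← hV]; exact Fintype.card_pos
  have key : ∀ v, silentPhase n (G.degree v) (config σ n (n + n) x v) =
      if (net σ n x (n + n) v).Reached then 1 else Circle.exp (Real.pi / n) := by
    intro v
    rw [silentPhase, localState_config le_rfl le_rfl]
  simp only [key]
  split_ifs with h
  · have hx : ∀ v, x v = false := fun v => congrFun h v
    simp only [if_neg (not_reached hx _ _)]
    rw [Finset.prod_const, Finset.card_univ, hV, Circle.coe_exp, ← Complex.exp_nat_mul]
    rw [← Complex.exp_pi_mul_I]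
    congr 1
    have : (n : ℂ) ≠ 0 := Nat.cast_ne_zero.2 hn.ne'
    push_cast
    field_simp
  · obtain ⟨r, hr⟩ : ∃ r, x r = true := by
      by_contra h'
      push Not at h'
      exact h (funext fun v => by simpa using h' v)
    refine Finset.prod_eq_one fun v _ => ?_
    rw [if_pos (reached_mono (k := n - 1) (by omega) (reached_of_connected hV hG hr v))]
    rfl

open Classical in
theorem leaderProbability_eq {K : ℕ → Matrix.unitaryGroup Bool ℂ} {a : (V → Bool) → ℂ}
    (h : (algorithm K).finalState n σ = embed (config σ n 0) a) :
    (algorithm K).leaderProbability n σ = ∑ x with ∃! v, x v = true, ‖a x‖ ^ 2 := by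
  rw [AnonymousQuantumAlgorithm.leaderProbability]
  symm
  refine Finset.sum_of_injOn (config σ n 0) config_zero_injective.injOn ?_ ?_ ?_
  · intro x hx
    exact Finset.mem_coe.2 (Finset.mem_filter.2 ⟨Finset.mem_univ _, (Finset.mem_filter.1 hx).2⟩)
  · intro b hb hb'
    have hb2 : b ∉ Set.range (config σ n 0) := by
      rintro ⟨x, rfl⟩
      exact hb' ⟨x, Finset.mem_coe.2 (Finset.mem_filter.2
        ⟨Finset.mem_univ _, (Finset.mem_filter.1 hb).2⟩), rfl⟩
    rw [h]
    have h0 := embed_apply_of_notMem hb2 a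
    exact (congrArg (fun r : ℂ => ‖r‖ ^ 2) h0).trans (by simp)
  · intro x _
    rw [h]
    exact (congrArg (fun r : ℂ => ‖r‖ ^ 2) (embed_apply_self config_zero_injective a x)).symm

theorem leaderProbability_eq_one (hV : Fintype.card V = n) (hG : G.Connected) {c s : ℕ → ℝ}
    (h : ∀ n, c n ^ 2 + s n ^ 2 = 1)
    (hcs : (n : ℝ) * (s n ^ 2 * (c n ^ 2) ^ (n - 1)) = 1 / 4) :
    (algorithm fun n => biasUnitary (c n) (s n) (h n)).leaderProbability n σ = 1 := by
  classical
  have hn : 0 < n := by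
    have := hG.nonempty
    rw [← hV]; exact Fintype.card_pos
  have hsum : ∑ x : V → Bool with ∃! v, x v = true,
      (∏ v, if x v = true then s n else c n) ^ 2 = 1 / 4 := by
    rw [sum_unique_candidate, hV, hcs]
  have hfinal := finalState_eq (σ := σ) (K := fun n => biasUnitary (c n) (s n) (h n)) hn
  simp only [prod_winnerPhase hV hG, prod_silentPhase hV hG, coe_biasUnitary] at hfinal
  rw [amplification (tensor_biasMatrix_mul_self (h n)) (transpose_tensor_biasMatrix _ _)] at hfinal
  · rw [leaderProbability_eq hfinal]
    -- Amplitudes double on the good inputs, so their total probability `1/4` becomes `1`.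
    have hterm : ∀ x ∈ Finset.univ.filter (fun x : V → Bool => ∃! v, x v = true),
        ‖(if ∃! v, x v = true then -2 * tensor (fun _ : V => biasMatrix (c n) (s n)) x
          (fun _ => false) else 0)‖ ^ 2 = 4 * (∏ v, if x v = true then s n else c n) ^ 2 := by
      intro x hx
      rw [if_pos (Finset.mem_filter.1 hx).2, tensor_biasMatrix_apply, norm_mul, mul_pow,
        Complex.norm_real, Real.norm_eq_abs, sq_abs]
      norm_num
    rw [Finset.sum_congr rfl hterm, ← Finset.mul_sum, hsum]
    norm_num
  · simp only [tensor_biasMatrix_apply]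
    have h4 := congrArg (fun r : ℝ => (r : ℂ)) hsum
    push_cast at h4 ⊢
    exact h4

theorem bitComplexity_le (A : AnonymousQuantumAlgorithm) (n : ℕ) :
    A.bitComplexity n σ ≤ A.rounds n * ((∑ v, G.degree v) * A.capacity n) := by
  have h1 : ∀ t v i, A.qubitsSent n σ t v i ≤ A.capacity n := fun t v i =>
    Finset.sup_le fun b _ => Nat.lt_succ_iff.1 ((b v).2.2 i).1.2
  calc A.bitComplexity n σ
      ≤ ∑ _t ∈ Finset.range (A.rounds n), ∑ v : V, ∑ _i : Fin (G.degree v), A.capacity n :=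
        Finset.sum_le_sum fun t _ => Finset.sum_le_sum fun v _ => Finset.sum_le_sum fun i _ =>
          h1 t v i
    _ = A.rounds n * ((∑ v, G.degree v) * A.capacity n) := by
        simp [Finset.sum_mul]

end Amplitudes

end LeaderElection

theorem corollary1 :
    ∃ (A : AnonymousQuantumAlgorithm) (C : ℕ),
      ∀ (n : ℕ) (G : SimpleGraph (Fin n)) [DecidableRel G.Adj], G.Connected →
        ∀ σ : PortNumbering G,
          A.leaderProbability n σ = 1 ∧
          A.rounds n ≤ C * n ∧
          A.bitComplexity n σ ≤ C * (G.edgeFinset.card * n ^ 2) := by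
  choose c s hcs hquarter using LeaderElection.exists_coin
  -- The constant comes from `8n` rounds, `2m` directed links and at most `n` qubits per message.
  refine ⟨LeaderElection.algorithm fun n => LeaderElection.biasUnitary (c n) (s n) (hcs n), 16,
    fun n G _ hG σ => ⟨?_, ?_, ?_⟩⟩
  · have hn : 0 < n := Fin.pos_iff_nonempty.2 hG.nonempty
    exact LeaderElection.leaderProbability_eq_one (Fintype.card_fin n) hG hcs (hquarter n hn)
  · change 4 * (n + n) ≤ 16 * n
    omega
  · refine (LeaderElection.bitComplexity_le _ n).trans ?_
    rw [SimpleGraph.sum_degrees_eq_twice_card_edges]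
    change 4 * (n + n) * (2 * G.edgeFinset.card * n) ≤ _
    apply le_of_eq
    ring
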